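/- Corollary 2.3. Equip each $\mathbb{R}^k$ with the Euclidean norm $|\cdot|$. A Borel probability measure $\mu$ on $\mathbb{R}^k$ is called log-concave if it has a density $e^{-V}$ with respect to Lebesgue measure, where $V:\mathbb{R}^k\to\mathbb{R}\cup\{+\infty\}$ is convex, and isotropic if $\int x\,\mu(dx)=0$ and $\int x_ix_j\,\mu(dx)=\delta_{ij}$ for all $1\le i,j\le k$. For a Lipschitz function $f:\mathbb{R}^k\to\mathbb{R}$ write $|\nabla f|(x)=\limsup_{y\to x,\,y\ne x}\frac{|f(y)-f(x)|}{|y-x|}$, which is the norm of the usual gradient wherever $f$ is differentiable. Then the following two statements are equivalent. (1) (The KLS conjecture, in its Poincaré form.) There is a constant $\lambda>0$ such that for every integer $k\ge 1$, every log-concave and isotropic probability measure $\mu$ on $\mathbb{R}^k$ and every Lipschitz function $f:\mathbb{R}^k\to\mathbb{R}$, $$\lambda\,\mathrm{Var}_\mu(f)\le\int|\nabla f|^2\,d\mu .$$ (2) There are constants $r_o>0$ and $a_o\in[0,1/2)$ such that for every integer $m\ge 1$, every log-concave and isotropic probability measure $\nu$ on $\mathbb{R}^m$ and every Borel set $A\subset\mathbb{R}^m$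 with $\nu(A)\ge 1/2$, $$\nu(A+r_oB_2)\ge 1-a_o ,$$ where $B_2$ is the closed Euclidean unit ball of $\mathbb{R}^m$. -/

import Mathlib

open Filter Topology MeasureTheory Pointwise
open scoped ENNReal

/-- A probability measure `μ` on `ℝ^k` is isotropic if `∫ x dμ = 0` and
`∫ x_i x_j dμ = δ_ij` for all `i`, `j`. (The case `i = j` of the second identity forces every
coordinate to be square integrable, so that all the integrals are genuine.) -/
def IsIsotropic {k : ℕ} (μ : Measure (EuclideanSpace ℝ (Fin k))) : Prop :=
  (∫ x, x ∂μ) = 0 ∧ ∀ i j : Fin k, ∫ x, x i * x j ∂μ = if i = j then 1 else 0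

/-- A measure on `ℝ^k` is log-concave if it has a density `e^{-V}` with respect to Lebesgue measure,
for a convex function `V : ℝ^k → ℝ ∪ {+∞}`. Such a function is the same thing as a convex set `S`
(where `V` is finite) with a real-valued convex function on `S`; off `S` the density is
`e^{-∞} = 0`. -/
def IsLogConcave {k : ℕ} (μ : Measure (EuclideanSpace ℝ (Fin k))) : Prop :=
  ∃ (S : Set (EuclideanSpace ℝ (Fin k))) (V : EuclideanSpace ℝ (Fin k) → ℝ),
    ConvexOn ℝ S V ∧
      μ = volume.withDensity (S.indicator fun x => ENNReal.ofReal (Real.exp (-V x)))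

/-- The length of the gradient of a real function on a metric space,
`|∇f|(x) = limsup_{y → x, y ≠ x} |f y - f x| / d(y, x)` (and `0` at an isolated point).
Where `f` is differentiable, this is the norm of the usual gradient. -/
noncomputable def gradLength {E : Type*} [MetricSpace E] (f : E → ℝ) (x : E) : ℝ≥0∞ :=
  limsup (fun y => ENNReal.ofReal (|f y - f x| / dist y x)) (𝓝[≠] x)

/-- The Poincaré inequality with constant `lam`: `lam * Var_μ(f) ≤ ∫ |∇f|² dμ` for every Lipschitz
function `f`. Both sides are taken in `[0, ∞]`; in particular, if `lam > 0` it includes that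
Lipschitz functions have finite variance. -/
def SatisfiesPoincare {E : Type*} [MetricSpace E] [MeasurableSpace E]
    (μ : Measure E) (lam : ℝ) : Prop :=
  ∀ f : E → ℝ, (∃ K, LipschitzWith K f) →
    ENNReal.ofReal lam * ProbabilityTheory.evariance f μ ≤ ∫⁻ x, gradLength f x ^ 2 ∂μ

/-!
The two implications are of very different nature.

*Poincaré implies concentration.* This holds for each measure separately. If `ν(A) ≥ 1/2`, the
function `min (d(·, A)) r` is `1`-Lipschitz, vanishes on `A` and equals `r` at distance at least `r`
from `A`, so its variance is at least `r² / 2` times the measure `b` of the latter set. The Poincaré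
inequality gives `b ≤ 2 / (λ r²)`, which is `1/4` for `r = √(8 / λ)`
(`SatisfiesPoincare.le_measure_add_closedBall`).

*Concentration implies Poincaré.* The powers `μⁿ` of an isotropic log-concave measure on `ℝ^k` are
isotropic and log-concave on `ℝ^(nk)` (`IsLogConcave.powMeasure`, `IsIsotropic.powMeasure`), so `μ`
satisfies concentration for all its powers with the same `r` and `a < 1/2`
(`productConcentration_of_powMeasure`). This is applied to the sets `{S_n ≤ η √n}`, where
`S_n = ∑ F(x_i)` for a Lipschitz function `F` with mean `0` and variance `1`; by the central limit
theorem these have measure more than `1/2` for large `n`. If `h(x)` is the largest slope of `F` at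
`x` at scales below `δ`, then `F(x) - F(z) ≤ h(x) |x - z| + (K / δ) |x - z|²` for all `x`, `z`, and
the Cauchy-Schwarz inequality gives
`S_n / √n ≤ η + r √((1/n) ∑ h(x_i)²) + O(1 / √n)` on the `r`-enlargement. The law of large numbers
replaces the empirical mean by `∫ h² dμ`, and the central limit theorem again shows that a standard
Gaussian variable is at most `r √(∫ h² dμ)`, up to an arbitrarily small error, with probability at
least `1 - a > 1/2`. Hence `c ≤ r √(∫ h² dμ)` for a number `c > 0` that depends only on `a`
(`ProductConcentration.quantile_le`). As `δ → 0`, `h` decreases to the gradient length, which is the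
Poincaré inequality with constant `(c / r)²` (`ProductConcentration.satisfiesPoincare`). No smoothness
of `F` and no property of log-concave measures besides stability under products is involved.
-/

open ProbabilityTheory

/-! ### Local Lipschitz constants -/

/-- The length of the gradient of a `K`-Lipschitz function is at most `K`. -/
lemma LipschitzWith.gradLength_le {E : Type*} [MetricSpace E] {f : E → ℝ} {K : NNReal}
    (hf : LipschitzWith K f) (x : E) : gradLength f x ≤ K := by
  refine limsup_le_of_le (by isBoundedDefault) ?_
  filter_upwards [self_mem_nhdsWithin] with y hy
  have h := hf.dist_le_mul y x
  rw [Real.dist_eq] at h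
  rw [← ENNReal.ofReal_coe_nnreal]
  exact ENNReal.ofReal_le_ofReal (div_le_of_le_mul₀ dist_nonneg K.2 h)

section LocalSlope

variable {E : Type*} [NormedAddCommGroup E]

/-- The largest slope `|f (x + h) - f x| / ‖h‖` of `f` at `x` over steps `0 < ‖h‖ < δ`. It
decreases to `gradLength f x` as `δ → 0`. Writing the second point as `x + h` makes the supremum
run over a set that does not depend on `x`, so that it is lower semicontinuous in `x`. -/
noncomputable def localSlope (f : E → ℝ) (δ : ℝ) (x : E) : ℝ≥0∞ :=
  ⨆ h : E, ⨆ _ : h ≠ 0 ∧ ‖h‖ < δ, ENNReal.ofReal (|f (x + h) - f x| / ‖h‖)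

lemma LipschitzWith.localSlope_le {f : E → ℝ} {K : NNReal} (hf : LipschitzWith K f) (δ : ℝ)
    (x : E) : localSlope f δ x ≤ K := by
  refine iSup₂_le fun h _ => ?_
  have := hf.dist_le_mul (x + h) x
  rw [Real.dist_eq, dist_eq_norm, add_sub_cancel_left] at this
  rw [← ENNReal.ofReal_coe_nnreal]
  exact ENNReal.ofReal_le_ofReal (div_le_of_le_mul₀ (norm_nonneg _) K.2 this)

lemma measurable_localSlope [MeasurableSpace E] [BorelSpace E] {f : E → ℝ} (hf : Continuous f)
    (δ : ℝ) : Measurable (localSlope f δ) := by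
  refine LowerSemicontinuous.measurable (lowerSemicontinuous_biSup fun h _ => ?_)
  exact (ENNReal.continuous_ofReal.comp (by fun_prop)).lowerSemicontinuous

lemma localSlope_mono (f : E → ℝ) (x : E) : Monotone fun δ => localSlope f δ x := by
  intro δ δ' hδ
  exact biSup_mono fun h hh => ⟨hh.1, hh.2.trans_le hδ⟩

lemma gradLength_eq_iInf_localSlope (f : E → ℝ) (x : E) :
    gradLength f x = ⨅ δ : ℝ, ⨅ _ : 0 < δ, localSlope f δ x := by
  rw [gradLength, (nhdsWithin_hasBasis Metric.nhds_basis_ball _).limsup_eq_iInf_iSup]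
  refine iInf_congr fun δ => iInf_congr fun _ => le_antisymm ?_ ?_
  · refine iSup₂_le fun y hy => ?_
    refine le_iSup₂_of_le (y - x) ⟨sub_ne_zero.2 hy.2, by simpa [dist_eq_norm] using hy.1⟩ ?_
    rw [add_sub_cancel, dist_eq_norm]
  · refine iSup₂_le fun h hh => ?_
    refine le_iSup₂_of_le (x + h) ⟨by simpa using hh.2, by simpa using hh.1⟩ ?_
    simp [dist_eq_norm]

lemma tendsto_localSlope (f : E → ℝ) (x : E) :
    Tendsto (fun n : ℕ => localSlope f (1 / ((n : ℝ) + 1)) x) atTop (𝓝 (gradLength f x)) := by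
  have hanti : Antitone fun n : ℕ => localSlope f (1 / ((n : ℝ) + 1)) x := fun m n hmn =>
    localSlope_mono f x (Nat.one_div_le_one_div hmn)
  convert tendsto_atTop_iInf hanti
  rw [gradLength_eq_iInf_localSlope]
  refine le_antisymm (le_iInf fun n => iInf₂_le _ Nat.one_div_pos_of_nat) ?_
  refine le_iInf₂ fun δ hδ => ?_
  obtain ⟨n, hn⟩ := exists_nat_one_div_lt hδ
  exact (iInf_le _ n).trans (localSlope_mono f x hn.le)

/-- Integrals of squared local slopes of a Lipschitz function converge to that of its squared
gradient length, by dominated convergence. -/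
lemma LipschitzWith.tendsto_lintegral_localSlope_sq [MeasurableSpace E] [BorelSpace E] {f : E → ℝ}
    {K : NNReal} (hf : LipschitzWith K f) (μ : Measure E) [IsFiniteMeasure μ] :
    Tendsto (fun n : ℕ => ∫⁻ x, localSlope f (1 / ((n : ℝ) + 1)) x ^ 2 ∂μ) atTop
      (𝓝 (∫⁻ x, gradLength f x ^ 2 ∂μ)) := by
  refine tendsto_lintegral_of_dominated_convergence (fun _ => (K : ℝ≥0∞) ^ 2)
    (fun n => (measurable_localSlope hf.continuous _).pow_const 2) (fun n => ?_) ?_ ?_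
  · exact ae_of_all _ fun x => pow_le_pow_left' (hf.localSlope_le _ x) 2
  · rw [lintegral_const]
    exact ENNReal.mul_ne_top (by simp) (measure_ne_top _ _)
  · exact ae_of_all _ fun x => ((ENNReal.continuous_pow 2).tendsto _).comp (tendsto_localSlope f x)

/-- At every scale, an increment of a Lipschitz function is controlled by its local slope, with an
error that is quadratic in the increment of the variable. -/
lemma LipschitzWith.sub_le_localSlope_mul {f : E → ℝ} {K : NNReal} (hf : LipschitzWith K f)
    {δ : ℝ} (hδ : 0 < δ) (x z : E) :
    f x - f z ≤ (localSlope f δ x).toReal * ‖x - z‖ + K / δ * ‖x - z‖ ^ 2 := by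
  have hK : f x - f z ≤ K * ‖x - z‖ := by
    have := hf.dist_le_mul x z
    rw [Real.dist_eq, dist_eq_norm] at this
    exact (le_abs_self _).trans this
  rcases lt_or_ge ‖x - z‖ δ with hlt | hge
  · rcases eq_or_ne x z with rfl | hne
    · simp
    have hpos : 0 < ‖z - x‖ := norm_pos_iff.2 (sub_ne_zero.2 hne.symm)
    have h1 : ENNReal.ofReal (|f z - f x| / ‖z - x‖) ≤ localSlope f δ x := by
      refine le_iSup₂_of_le (z - x) ⟨sub_ne_zero.2 hne.symm, by rwa [norm_sub_rev]⟩ ?_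
      rw [add_sub_cancel]
    have h2 := ENNReal.toReal_mono (ne_top_of_le_ne_top ENNReal.coe_ne_top
      (hf.localSlope_le δ x)) h1
    rw [ENNReal.toReal_ofReal (by positivity), div_le_iff₀ hpos] at h2
    rw [norm_sub_rev z x] at h2
    have h3 : f x - f z ≤ |f z - f x| := by rw [abs_sub_comm]; exact le_abs_self _
    have : 0 ≤ K / δ * ‖x - z‖ ^ 2 := by positivity
    linarith
  -- For long increments the Lipschitz bound `K ‖x - z‖` is absorbed by the quadratic term.
  · have h1 : K * ‖x - z‖ ≤ K / δ * ‖x - z‖ ^ 2 := by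
      rw [div_mul_eq_mul_div, le_div_iff₀ hδ, pow_two, ← mul_assoc]
      gcongr
    have : 0 ≤ (localSlope f δ x).toReal * ‖x - z‖ := by positivity
    linarith

end LocalSlope

/-! ### From the Poincaré inequality to concentration -/

/-- Chebyshev's inequality for the distance to a set of measure at least `1 / 2`, cut off at `r`:
a Poincaré inequality bounds the measure of the points at distance at least `r` from the set. -/
lemma SatisfiesPoincare.measure_le_infDist {E : Type*} [MetricSpace E] [MeasurableSpace E]
    [BorelSpace E] {μ : Measure E} [IsProbabilityMeasure μ] {lam : ℝ} (hlam : 0 < lam)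
    (h : SatisfiesPoincare μ lam) {A : Set E} (hA : MeasurableSet A) (hA2 : 1 / 2 ≤ μ A)
    {r : ℝ} (hr : 0 < r) :
    μ {x | r ≤ Metric.infDist x A} ≤ ENNReal.ofReal (2 / (lam * r ^ 2)) := by
  set f : E → ℝ := fun x => min (Metric.infDist x A) r with hf
  set C : Set E := {x | r ≤ Metric.infDist x A} with hC
  have hCm : MeasurableSet C := measurableSet_le measurable_const
    (Metric.continuous_infDist_pt A).measurable
  have hlip : LipschitzWith 1 f := (Metric.lipschitz_infDist_pt A).min_const r
  have hdisj : Disjoint A C := by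
    rw [Set.disjoint_left]
    intro x hx hxC
    have : r ≤ Metric.infDist x A := hxC
    rw [Metric.infDist_zero_of_mem hx] at this
    linarith
  have hA2' : 1 / 2 ≤ μ.real A := by
    have := ENNReal.toReal_mono (measure_ne_top _ _) hA2
    simpa [Measure.real] using this
  have hb : μ.real C ≤ 1 / 2 := by
    have h1 : μ.real A + μ.real C ≤ 1 := by
      rw [← measureReal_union hdisj hCm]; exact measureReal_le_one
    linarith
  set M := ∫ x, f x ∂μ
  -- Whatever the mean `M` is, `f - M` takes the value `-M` on `A` and `r - M` on `C`.
  have hvar : ENNReal.ofReal (μ.real C * r ^ 2 / 2) ≤ evariance f μ := by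
    rw [evariance_eq_lintegral_ofReal]
    calc ENNReal.ofReal (μ.real C * r ^ 2 / 2)
        ≤ ENNReal.ofReal (M ^ 2 * μ.real A + (r - M) ^ 2 * μ.real C) := by
          refine ENNReal.ofReal_le_ofReal ?_
          have h0 : 0 ≤ μ.real C := measureReal_nonneg
          have h1 : M ^ 2 * μ.real C ≤ M ^ 2 * μ.real A :=
            mul_le_mul_of_nonneg_left (hb.trans hA2') (sq_nonneg M)
          have h2 : r ^ 2 / 2 * μ.real C ≤ (M ^ 2 + (r - M) ^ 2) * μ.real C := by
            gcongr; nlinarith [sq_nonneg (2 * M - r)]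
          linarith
      _ = ∫⁻ x in A, ENNReal.ofReal (M ^ 2) ∂μ + ∫⁻ x in C, ENNReal.ofReal ((r - M) ^ 2) ∂μ := by
          rw [setLIntegral_const, setLIntegral_const, ENNReal.ofReal_add (by positivity)
            (by positivity), ENNReal.ofReal_mul (by positivity), ENNReal.ofReal_mul (by positivity),
            ofReal_measureReal, ofReal_measureReal]
      _ = ∫⁻ x in A, ENNReal.ofReal ((f x - M) ^ 2) ∂μ
            + ∫⁻ x in C, ENNReal.ofReal ((f x - M) ^ 2) ∂μ := by
          congr 1
          · refine setLIntegral_congr_fun hA fun x hx => ?_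
            simp [hf, Metric.infDist_zero_of_mem hx, hr.le]
          · refine setLIntegral_congr_fun hCm fun x hx => ?_
            simp only [hf]
            rw [min_eq_right hx]
      _ = ∫⁻ x in A ∪ C, ENNReal.ofReal ((f x - M) ^ 2) ∂μ := (lintegral_union hCm hdisj).symm
      _ ≤ ∫⁻ x, ENNReal.ofReal ((f x - M) ^ 2) ∂μ := setLIntegral_le_lintegral _ _
  have hgrad : ∫⁻ x, gradLength f x ^ 2 ∂μ ≤ 1 := by
    calc ∫⁻ x, gradLength f x ^ 2 ∂μ ≤ ∫⁻ _, 1 ∂μ := by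
          refine lintegral_mono fun x => ?_
          exact pow_le_one' (by simpa using hlip.gradLength_le x) 2
      _ = 1 := by simp
  have key : ENNReal.ofReal (lam * (μ.real C * r ^ 2 / 2)) ≤ ENNReal.ofReal 1 := by
    rw [ENNReal.ofReal_mul hlam.le, ENNReal.ofReal_one]
    exact (mul_le_mul_right hvar _).trans ((h f ⟨1, hlip⟩).trans hgrad)
  rw [ENNReal.ofReal_le_ofReal_iff zero_le_one] at key
  rw [← ofReal_measureReal (μ := μ)]
  refine ENNReal.ofReal_le_ofReal ?_
  rw [le_div_iff₀ (by positivity)]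
  linarith

/-- Points at distance less than `r` from `A` lie in `A + r B`, where `B` is the closed unit
ball. -/
lemma setOf_infDist_lt_subset_add_smul_closedBall {E : Type*} [NormedAddCommGroup E]
    [NormedSpace ℝ E] {A : Set E} (hA : A.Nonempty) (r : ℝ) :
    {x | Metric.infDist x A < r} ⊆ A + r • Metric.closedBall (0 : E) 1 := by
  intro x hx
  have hr : 0 < r := Metric.infDist_nonneg.trans_lt hx
  obtain ⟨y, hy, hxy⟩ := (Metric.infDist_lt_iff hA).1 hx
  refine Set.mem_add.2 ⟨y, hy, x - y, ?_, by abel⟩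
  rw [smul_closedBall _ _ zero_le_one, smul_zero, Real.norm_of_nonneg hr.le, mul_one,
    mem_closedBall_zero_iff, ← dist_eq_norm]
  exact hxy.le

/-- A Poincaré inequality gives concentration at a radius that depends only on its constant. -/
lemma SatisfiesPoincare.le_measure_add_closedBall {E : Type*} [NormedAddCommGroup E]
    [NormedSpace ℝ E] [MeasurableSpace E] [BorelSpace E] {μ : Measure E} [IsProbabilityMeasure μ]
    {lam : ℝ} (hlam : 0 < lam) (h : SatisfiesPoincare μ lam) {A : Set E} (hA : MeasurableSet A)
    (hA2 : 1 / 2 ≤ μ A) :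
    ENNReal.ofReal (1 - 1 / 4) ≤ μ (A + √(8 / lam) • Metric.closedBall (0 : E) 1) := by
  have hr : 0 < √(8 / lam) := by positivity
  have h1 := h.measure_le_infDist hlam hA hA2 hr
  have hne : A.Nonempty := by
    refine nonempty_of_measure_ne_zero (μ := μ) fun h0 => ?_
    simp [h0] at hA2
  have hC : MeasurableSet {x | √(8 / lam) ≤ Metric.infDist x A} :=
    measurableSet_le measurable_const (Metric.continuous_infDist_pt A).measurable
  have hval : 2 / (lam * √(8 / lam) ^ 2) = 1 / 4 := by
    rw [Real.sq_sqrt (by positivity)]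
    field_simp
    norm_num
  rw [hval] at h1
  calc ENNReal.ofReal (1 - 1 / 4) = 1 - ENNReal.ofReal (1 / 4) := by
        rw [ENNReal.ofReal_sub _ (by norm_num), ENNReal.ofReal_one]
    _ ≤ 1 - μ {x | √(8 / lam) ≤ Metric.infDist x A} := tsub_le_tsub_left h1 _
    _ = μ {x | √(8 / lam) ≤ Metric.infDist x A}ᶜ := (prob_compl_eq_one_sub hC).symm
    _ ≤ _ := by
        refine measure_mono fun x hx => setOf_infDist_lt_subset_add_smul_closedBall hne _ ?_
        simpa using hx

/-! ### Quantiles of the standard Gaussian -/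

lemma gaussianReal_Iio_zero : gaussianReal 0 1 (Set.Iio 0) = 1 / 2 := by
  have hna : NullSingletonClass (gaussianReal 0 1) := nullSingletonClass_gaussianReal one_ne_zero
  have h1 : gaussianReal 0 1 (Set.Iio 0) = gaussianReal 0 1 (Set.Ioi 0) := by
    conv_lhs => rw [← neg_zero (G := ℝ), ← gaussianReal_map_neg]
    rw [Measure.map_apply measurable_neg measurableSet_Iio]
    congr 1
    ext x
    simp
  have h2 : gaussianReal 0 1 (Set.Iio 0) + gaussianReal 0 1 (Set.Ici 0) = 1 := by
    rw [← Set.compl_Iio]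
    exact prob_add_prob_compl measurableSet_Iio
  rw [← measure_congr Ioi_ae_eq_Ici, ← h1, ← two_mul, mul_comm] at h2
  exact ENNReal.eq_div_iff (by simp) (by simp) |>.2 (by rw [mul_comm]; exact h2)

lemma half_lt_gaussianReal_Iio {η : ℝ} (hη : 0 < η) : 1 / 2 < gaussianReal 0 1 (Set.Iio η) := by
  have hpos : gaussianReal 0 1 (Set.Ioo 0 η) ≠ 0 := by
    intro h0
    have := (gaussianReal_absolutelyContinuous' 0 one_ne_zero) h0
    simp [hη.not_ge] at this
  rw [← gaussianReal_Iio_zero]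
  calc gaussianReal 0 1 (Set.Iio 0)
      < gaussianReal 0 1 (Set.Iio 0) + gaussianReal 0 1 (Set.Ioo 0 η) :=
        ENNReal.lt_add_right (measure_ne_top _ _) hpos
    _ = gaussianReal 0 1 (Set.Iio 0 ∪ Set.Ioo 0 η) := by
        refine (measure_union ?_ measurableSet_Ioo).symm
        rw [Set.disjoint_left]
        exact fun x hx hx' => lt_asymm hx hx'.1
    _ ≤ gaussianReal 0 1 (Set.Iio η) := by
        refine measure_mono (Set.union_subset (Set.Iio_subset_Iio hη.le) fun x hx => hx.2)

lemma exists_pos_gaussianReal_Iic_lt {p : ℝ≥0∞} (hp : 1 / 2 < p) :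
    ∃ c : ℝ, 0 < c ∧ gaussianReal 0 1 (Set.Iic c) < p := by
  have hna : NullSingletonClass (gaussianReal 0 1) := nullSingletonClass_gaussianReal one_ne_zero
  have hlim : Tendsto (fun n : ℕ => gaussianReal 0 1 (Set.Iic (1 / ((n : ℝ) + 1)))) atTop
      (𝓝 (gaussianReal 0 1 (⋂ n : ℕ, Set.Iic (1 / ((n : ℝ) + 1))))) :=
    tendsto_measure_iInter_atTop (fun n => measurableSet_Iic.nullMeasurableSet)
      (fun m n hmn => Set.Iic_subset_Iic.2 (Nat.one_div_le_one_div hmn))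
      ⟨0, measure_ne_top _ _⟩
  have hinter : (⋂ n : ℕ, Set.Iic (1 / ((n : ℝ) + 1))) = Set.Iic 0 := by
    ext x
    simp only [Set.mem_iInter, Set.mem_Iic]
    refine ⟨fun h => ge_of_tendsto' tendsto_one_div_add_atTop_nhds_zero_nat h, fun h n => ?_⟩
    exact h.trans Nat.one_div_pos_of_nat.le
  rw [hinter, ← measure_congr Iio_ae_eq_Iic, gaussianReal_Iio_zero] at hlim
  obtain ⟨n, hn⟩ := (hlim.eventually_lt_const hp).exists
  exact ⟨_, Nat.one_div_pos_of_nat, hn⟩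

/-! ### From dimension-free concentration to the Poincaré inequality -/

/-- Concentration at radius `r` and level `1 - a`, uniformly in `n`, for the `n`-fold product of `μ`
with the `ℓ²` product distance. The enlargement of a measurable set need not be measurable; its
measure is the outer measure. -/
def ProductConcentration {E : Type*} [NormedAddCommGroup E] [MeasurableSpace E] (μ : Measure E)
    (r a : ℝ) : Prop :=
  ∀ n : ℕ, 0 < n → ∀ B : Set (Fin n → E), MeasurableSet B →
    1 / 2 ≤ Measure.pi (fun _ => μ) B →
      ENNReal.ofReal (1 - a) ≤
        Measure.pi (fun _ => μ) {x | ∃ z ∈ B, ∑ i, ‖x i - z i‖ ^ 2 ≤ r ^ 2}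

lemma map_infinitePi_fin {E : Type*} [MeasurableSpace E] (μ : Measure E)
    [IsProbabilityMeasure μ] (n : ℕ) :
    (Measure.infinitePi fun _ : ℕ => μ).map (fun ω (i : Fin n) => ω i) =
      Measure.pi fun _ => μ := by
  rw [Measure.map_infinitePi_infinitePi_of_inj (P := fun _ : ℕ => μ) Fin.val_injective,
    Measure.infinitePi_eq_pi]

/-- Summing the one-coordinate increment bounds with the Cauchy-Schwarz inequality. -/
lemma sum_sub_le_of_sum_sq_le {ι E : Type*} [Fintype ι] [NormedAddCommGroup E] {F h : E → ℝ}
    {L r : ℝ} (hL : 0 ≤ L) (hr : 0 ≤ r)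
    (hinc : ∀ x z, F x - F z ≤ h x * ‖x - z‖ + L * ‖x - z‖ ^ 2) {x z : ι → E}
    (hxz : ∑ i, ‖x i - z i‖ ^ 2 ≤ r ^ 2) :
    ∑ i, F (x i) ≤ ∑ i, F (z i) + √(∑ i, h (x i) ^ 2) * r + L * r ^ 2 := by
  have hcs : ∑ i, h (x i) * ‖x i - z i‖ ≤ √(∑ i, h (x i) ^ 2) * r := by
    refine (Real.sum_mul_le_sqrt_mul_sqrt _ _ _).trans ?_
    gcongr
    exact Real.sqrt_le_iff.2 ⟨hr, hxz⟩
  have h2 : L * ∑ i, ‖x i - z i‖ ^ 2 ≤ L * r ^ 2 := by gcongr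
  have h1 : ∑ i, (F (x i) - F (z i)) ≤
      ∑ i, (h (x i) * ‖x i - z i‖ + L * ‖x i - z i‖ ^ 2) := Finset.sum_le_sum fun i _ => hinc _ _
  rw [Finset.sum_sub_distrib, Finset.sum_add_distrib, ← Finset.mul_sum] at h1
  linarith

lemma integral_infinitePi_eval {E : Type*} [MeasurableSpace E] (μ : Measure E)
    [IsProbabilityMeasure μ] {G : E → ℝ} (hG : Measurable G) (i : ℕ) :
    ∫ ω, G (ω i) ∂(Measure.infinitePi fun _ : ℕ => μ) = ∫ x, G x ∂μ := by
  have h := measurePreserving_eval_infinitePi (fun _ : ℕ => μ) i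
  have h2 := integral_map h.measurable.aemeasurable
    (hG.aestronglyMeasurable (μ := (Measure.infinitePi fun _ : ℕ => μ).map (Function.eval i)))
  rw [h.map_eq] at h2
  exact h2.symm

lemma identDistrib_infinitePi_eval {E : Type*} [MeasurableSpace E] (μ : Measure E)
    [IsProbabilityMeasure μ] {G : E → ℝ} (hG : Measurable G) (i j : ℕ) :
    IdentDistrib (fun ω : ℕ → E => G (ω i)) (fun ω => G (ω j))
      (Measure.infinitePi fun _ : ℕ => μ) (Measure.infinitePi fun _ : ℕ => μ) := by
  have h : IdentDistrib (Function.eval i) (Function.eval j) (Measure.infinitePi fun _ : ℕ => μ)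
      (Measure.infinitePi fun _ : ℕ => μ) :=
    ⟨(measurable_pi_apply i).aemeasurable, (measurable_pi_apply j).aemeasurable, by
      rw [(measurePreserving_eval_infinitePi (fun _ : ℕ => μ) i).map_eq,
        (measurePreserving_eval_infinitePi (fun _ : ℕ => μ) j).map_eq]⟩
  exact h.comp hG

/-- By the weak law of large numbers, the empirical mean of `G` rarely exceeds its expectation by
more than a given amount. -/
lemma tendsto_measure_lt_sum_infinitePi {E : Type*} [MeasurableSpace E] (μ : Measure E)
    [IsProbabilityMeasure μ] {G : E → ℝ} (hG : Measurable G) (hint : Integrable G μ) {t : ℝ}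
    (ht : ∫ x, G x ∂μ < t) :
    Tendsto (fun n : ℕ => (Measure.infinitePi fun _ : ℕ => μ)
      {ω | t < (∑ i ∈ Finset.range n, G (ω i)) / n}) atTop (𝓝 0) := by
  set P := Measure.infinitePi fun _ : ℕ => μ
  have hind : iIndepFun (fun (i : ℕ) (ω : ℕ → E) => G (ω i)) P :=
    iIndepFun_infinitePi (X := fun _ => G) fun _ => hG
  have hint0 : Integrable (fun ω : ℕ → E => G (ω 0)) P :=
    (measurePreserving_eval_infinitePi (fun _ : ℕ => μ) 0).integrable_comp_of_integrable hint
  have hae := strong_law_ae_real (fun (i : ℕ) (ω : ℕ → E) => G (ω i)) hint0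
    (fun i j hij => hind.indepFun hij) (fun i => identDistrib_infinitePi_eval μ hG i 0)
  rw [integral_infinitePi_eval μ hG 0] at hae
  have hm := tendstoInMeasure_of_tendsto_ae (fun n => Measurable.aestronglyMeasurable
    (by fun_prop)) hae
  rw [tendstoInMeasure_iff_dist] at hm
  refine tendsto_of_tendsto_of_tendsto_of_le_of_le tendsto_const_nhds
    (hm (t - ∫ x, G x ∂μ) (by linarith)) (fun _ => zero_le) fun n => measure_mono ?_
  intro ω hω
  have : t < (∑ i ∈ Finset.range n, G (ω i)) / n := hω
  simp only [Set.mem_ofPred_eq, Real.dist_eq]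
  exact le_trans (by linarith) (le_abs_self _)

/-- Dimension-free concentration applied to the half-space-like sets `{S_n ≤ η √n}`, where `S_n` is
the sum of a centered and normalized function `F` over the coordinates. On the enlargement of this
set, `S_n / √n` is at most about `r` times the quadratic mean of the slope `h`, so that in the limit
the Gaussian quantile `c` is below that bound. -/
lemma ProductConcentration.quantile_le {E : Type*} [NormedAddCommGroup E] [MeasurableSpace E]
    {μ : Measure E} [IsProbabilityMeasure μ] {r a c : ℝ} (hr : 0 ≤ r)
    (hconc : ProductConcentration μ r a)
    (hc : gaussianReal 0 1 (Set.Iic c) < ENNReal.ofReal (1 - a)) {F h : E → ℝ} {L : ℝ} (hL : 0 ≤ L)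
    (hF : Measurable F) (hF0 : ∫ x, F x ∂μ = 0) (hF1 : ∫ x, F x ^ 2 ∂μ = 1)
    (hh : Measurable h) (hh2 : Integrable (fun x => h x ^ 2) μ)
    (hinc : ∀ x z, F x - F z ≤ h x * ‖x - z‖ + L * ‖x - z‖ ^ 2) :
    c ≤ r * √(∫ x, h x ^ 2 ∂μ) := by
  by_contra! hlt
  set P := Measure.infinitePi fun _ : ℕ => μ with hP
  -- Room between the two sides: `I` exceeds the integral and `2 η + r √I ≤ c`.
  obtain ⟨I, η, hI, hη, hIη⟩ : ∃ I η : ℝ, ∫ x, h x ^ 2 ∂μ < I ∧ 0 < η ∧ 2 * η + r * √I ≤ c := by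
    have hcont : Tendsto (fun I : ℝ => r * √I) (𝓝[>] (∫ x, h x ^ 2 ∂μ))
        (𝓝 (r * √(∫ x, h x ^ 2 ∂μ))) := by
      have : Continuous fun I : ℝ => r * √I := by fun_prop
      exact this.continuousAt.tendsto.mono_left nhdsWithin_le_nhds
    obtain ⟨I, hI1, hI2⟩ := ((hcont.eventually_lt_const hlt).and self_mem_nhdsWithin).exists
    exact ⟨I, (c - r * √I) / 2, hI2, by linarith, by linarith⟩
  set S : ℕ → (ℕ → E) → ℝ := fun n ω => (√n)⁻¹ * ∑ k ∈ Finset.range n, F (ω k) with hS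
  have hSm : ∀ n, Measurable (S n) := fun n => by simp only [hS]; fun_prop
  have hclt : TendstoInDistribution S atTop (id : ℝ → ℝ) (fun _ => P) (gaussianReal 0 1) := by
    refine tendstoInDistribution_inv_sqrt_mul_sum (X := fun k (ω : ℕ → E) => F (ω k)) HasLaw.id ?_ ?_
      (iIndepFun_infinitePi (X := fun _ => F) fun _ => hF)
      (fun i => identDistrib_infinitePi_eval μ hF i 0)
    · rw [integral_infinitePi_eval μ hF, hF0]
    · simp only [Pi.pow_apply]
      rw [integral_infinitePi_eval μ (hF.pow_const 2), hF1]
  -- The central limit theorem makes `{S_n ≤ η}` an admissible set for large `n`.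
  have hlower : ∀ᶠ n in atTop, 1 / 2 < P {ω | S n ω ≤ η} := by
    have h1 := ProbabilityMeasure.le_liminf_measure_open_of_tendsto hclt.tendsto
      (isOpen_Iio (a := η))
    simp only [ProbabilityMeasure.coe_mk, Measure.map_id] at h1
    filter_upwards [eventually_lt_of_lt_liminf ((half_lt_gaussianReal_Iio hη).trans_le h1)]
      with n hn
    rw [Measure.map_apply (hSm n) measurableSet_Iio] at hn
    exact hn.trans_le (measure_mono fun ω (hω : S n ω < η) => hω.le)
  have hupper : ∀ᶠ n in atTop, P {ω | I < (∑ i ∈ Finset.range n, h (ω i) ^ 2) / n} +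
      P {ω | S n ω ≤ c} < ENNReal.ofReal (1 - a) := by
    obtain ⟨q, hq1, hq2⟩ := exists_between hc
    have h1 := ProbabilityMeasure.limsup_measure_closed_le_of_tendsto hclt.tendsto
      (isClosed_Iic (a := c))
    simp only [ProbabilityMeasure.coe_mk, Measure.map_id] at h1
    filter_upwards [eventually_lt_of_limsup_lt (h1.trans_lt hq1),
      (tendsto_measure_lt_sum_infinitePi μ (hh.pow_const 2) hh2 hI).eventually_lt_const
        (tsub_pos_of_lt hq2)] with n hn hn'
    rw [Measure.map_apply (hSm n) measurableSet_Iic] at hn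
    rw [← tsub_add_cancel_of_le hq2.le]
    exact ENNReal.add_lt_add hn' hn
  have hsmall : ∀ᶠ n : ℕ in atTop, (√n)⁻¹ * (L * r ^ 2) ≤ η := by
    have : Tendsto (fun n : ℕ => (√(n : ℝ))⁻¹ * (L * r ^ 2)) atTop (𝓝 (0 * (L * r ^ 2))) :=
      (tendsto_inv_atTop_zero.comp
        (Real.tendsto_sqrt_atTop.comp tendsto_natCast_atTop_atTop)).mul_const _
    rw [zero_mul] at this
    exact (this.eventually_lt_const hη).mono fun n hn => hn.le
  obtain ⟨n, ⟨⟨hn1, hn2⟩, hn3⟩, hn0⟩ :=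
    (((hlower.and hupper).and hsmall).and (eventually_gt_atTop 0)).exists
  refine hn2.not_ge ?_
  set B : Set (Fin n → E) := {x | (√n)⁻¹ * ∑ i, F (x i) ≤ η} with hB
  have hBm : MeasurableSet B := measurableSet_le (by fun_prop) measurable_const
  have hproj : Measurable fun (ω : ℕ → E) (i : Fin n) => ω i := by fun_prop
  have hB2 : 1 / 2 ≤ Measure.pi (fun _ => μ) B := by
    have hpre : (fun (ω : ℕ → E) (i : Fin n) => ω i) ⁻¹' B = {ω | S n ω ≤ η} := by
      ext ω
      simp [hS, hB, Finset.sum_range]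
    rw [← map_infinitePi_fin μ n, Measure.map_apply hproj hBm, hpre]
    exact hn1.le
  set C₁ : Set (Fin n → E) := {x | I < (∑ i, h (x i) ^ 2) / n} with hC₁
  set C₂ : Set (Fin n → E) := {x | (√n)⁻¹ * ∑ i, F (x i) ≤ c} with hC₂
  have hC₁m : MeasurableSet C₁ := measurableSet_lt measurable_const (by fun_prop)
  have hC₂m : MeasurableSet C₂ := measurableSet_le (by fun_prop) measurable_const
  calc ENNReal.ofReal (1 - a)
      ≤ Measure.pi (fun _ => μ) {x | ∃ z ∈ B, ∑ i, ‖x i - z i‖ ^ 2 ≤ r ^ 2} :=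
        hconc n hn0 B hBm hB2
    _ ≤ Measure.pi (fun _ => μ) (C₁ ∪ C₂) := by
        refine measure_mono ?_
        rintro x ⟨z, hz, hxz⟩
        rw [Set.mem_union, or_iff_not_imp_left]
        intro hx
        have hx : √((∑ i, h (x i) ^ 2) / n) ≤ √I := Real.sqrt_le_sqrt (not_lt.1 hx)
        have hz : (√n)⁻¹ * ∑ i, F (z i) ≤ η := hz
        change (√n)⁻¹ * ∑ i, F (x i) ≤ c
        have hsum := mul_le_mul_of_nonneg_left (sum_sub_le_of_sum_sq_le hL hr hinc hxz)
          (inv_nonneg.2 (Real.sqrt_nonneg (n : ℝ)))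
        rw [Real.sqrt_div' _ (Nat.cast_nonneg n), div_eq_inv_mul] at hx
        have := mul_le_mul_of_nonneg_left hx hr
        linarith
    _ ≤ Measure.pi (fun _ => μ) C₁ + Measure.pi (fun _ => μ) C₂ := measure_union_le _ _
    _ = _ := by
        rw [← map_infinitePi_fin μ n, Measure.map_apply hproj hC₁m, Measure.map_apply hproj hC₂m]
        congr 2
        · ext ω; simp [hC₁, Finset.sum_range]
        · ext ω; simp [hC₂, hS, Finset.sum_range]

/-- Dimension-free concentration for the powers of a measure implies a Poincaré inequality. -/
theorem ProductConcentration.satisfiesPoincare {E : Type*} [NormedAddCommGroup E]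
    [MeasurableSpace E] [BorelSpace E] {μ : Measure E} [IsProbabilityMeasure μ] {r a c : ℝ}
    (hr : 0 < r) (hconc : ProductConcentration μ r a) (hc0 : 0 < c)
    (hc : gaussianReal 0 1 (Set.Iic c) < ENNReal.ofReal (1 - a))
    (hmem : Integrable (fun x => ‖x‖ ^ 2) μ) : SatisfiesPoincare μ ((c / r) ^ 2) := by
  rintro f ⟨K, hK⟩
  have hfm : Measurable f := hK.continuous.measurable
  have hf2 : MemLp f 2 μ := by
    have hbound : Integrable (fun x => 2 * |f 0| ^ 2 + 2 * K ^ 2 * ‖x‖ ^ 2) μ :=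
      (integrable_const _).add (hmem.const_mul _)
    rw [memLp_two_iff_integrable_sq hfm.aestronglyMeasurable]
    refine hbound.mono' (hfm.pow_const 2).aestronglyMeasurable (ae_of_all _ fun x => ?_)
    have h1 : |f x| ≤ |f 0| + K * ‖x‖ := by
      have := hK.dist_le_mul x 0
      rw [Real.dist_eq, dist_zero_right] at this
      have h2 := abs_sub_abs_le_abs_sub (f x) (f 0)
      linarith
    rw [Real.norm_of_nonneg (sq_nonneg _), ← sq_abs]
    calc |f x| ^ 2 ≤ (|f 0| + K * ‖x‖) ^ 2 := by gcongr
      _ ≤ _ := by nlinarith [sq_nonneg (|f 0| - K * ‖x‖)]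
  rw [← hf2.ofReal_variance_eq]
  set v := Var[f; μ] with hv
  set M := ∫ x, f x ∂μ with hM
  rcases (variance_nonneg f μ).eq_or_lt with h0 | hvpos
  · rw [hv, ← h0]
    simp
  refine ge_of_tendsto' (hK.tendsto_lintegral_localSlope_sq μ) fun n => ?_
  set δ : ℝ := 1 / ((n : ℝ) + 1) with hδ
  have hδ0 : 0 < δ := Nat.one_div_pos_of_nat
  have hσ : 0 < √v := Real.sqrt_pos.2 hvpos
  set s : E → ℝ := fun x => (localSlope f δ x).toReal with hs
  have hsm : Measurable s := (measurable_localSlope hK.continuous δ).ennreal_toReal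
  have hfin : ∀ x, localSlope f δ x ≠ ∞ := fun x =>
    ne_top_of_le_ne_top ENNReal.coe_ne_top (hK.localSlope_le δ x)
  have hsint : Integrable (fun x => s x ^ 2) μ := by
    refine (integrable_const ((K : ℝ) ^ 2)).mono' (hsm.pow_const 2).aestronglyMeasurable
      (ae_of_all _ fun x => ?_)
    rw [Real.norm_of_nonneg (sq_nonneg _)]
    have : s x ≤ K := ENNReal.toReal_mono ENNReal.coe_ne_top (hK.localSlope_le δ x)
    gcongr
  have hquant := hconc.quantile_le hr.le hc (F := fun x => (f x - M) / √v)
    (h := fun x => s x / √v) (L := K / δ / √v) (by positivity) (by fun_prop)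
    (by rw [integral_div, integral_sub (hf2.integrable one_le_two) (integrable_const _)]; simp [hM])
    (by
      simp_rw [div_pow]
      rw [integral_div, ← variance_eq_integral hfm.aemeasurable, Real.sq_sqrt hvpos.le,
        div_self hvpos.ne'])
    (hsm.div_const _) (by simp_rw [div_pow]; exact hsint.div_const _)
    (fun x z => by
      have := hK.sub_le_localSlope_mul hδ0 x z
      calc (f x - M) / √v - (f z - M) / √v = (f x - f z) / √v := by ring
        _ ≤ (s x * ‖x - z‖ + K / δ * ‖x - z‖ ^ 2) / √v := by gcongr
        _ = _ := by ring)
  have hint : ∫⁻ x, localSlope f δ x ^ 2 ∂μ = ENNReal.ofReal (∫ x, s x ^ 2 ∂μ) := by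
    rw [ofReal_integral_eq_lintegral_ofReal hsint (ae_of_all _ fun x => sq_nonneg _)]
    refine lintegral_congr fun x => ?_
    rw [ENNReal.ofReal_pow ENNReal.toReal_nonneg, ENNReal.ofReal_toReal (hfin x)]
  rw [hint, ← ENNReal.ofReal_mul (sq_nonneg _)]
  refine ENNReal.ofReal_le_ofReal ?_
  simp_rw [div_pow] at hquant
  rw [integral_div, Real.sq_sqrt hvpos.le] at hquant
  have hI : 0 ≤ ∫ x, s x ^ 2 ∂μ := integral_nonneg fun x => sq_nonneg _
  have h2 : c ^ 2 ≤ r ^ 2 * ((∫ x, s x ^ 2 ∂μ) / v) := by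
    rw [← Real.sq_sqrt (div_nonneg hI hvpos.le), ← mul_pow]
    gcongr
  rw [div_pow, div_mul_eq_mul_div, div_le_iff₀ (by positivity)]
  rw [← mul_div_assoc, le_div_iff₀ hvpos] at h2
  linarith

/-! ### Powers of isotropic log-concave measures -/

lemma MeasureTheory.Measure.pi_withDensity_ofReal {ι : Type*} [Fintype ι] {E : Type*}
    [MeasurableSpace E] (μ : Measure E) [SigmaFinite μ] {ρ : E → ℝ}
    (hρ0 : 0 ≤ ρ) (hint : Integrable ρ μ) :
    Measure.pi (fun _ : ι => μ.withDensity fun x => ENNReal.ofReal (ρ x)) =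
      (Measure.pi fun _ : ι => μ).withDensity fun x => ENNReal.ofReal (∏ i, ρ (x i)) := by
  have : IsFiniteMeasure (μ.withDensity fun x => ENNReal.ofReal (ρ x)) :=
    isFiniteMeasure_withDensity_ofReal hint.2
  refine Measure.pi_eq fun s hs => ?_
  have hind : ∀ i, Integrable ((s i).indicator ρ) μ := fun i => hint.indicator (hs i)
  have hpos : ∀ i x, 0 ≤ (s i).indicator ρ x := fun i => Set.indicator_nonneg fun x _ => hρ0 x
  rw [withDensity_apply _ (MeasurableSet.univ_pi hs), ← lintegral_indicator
    (MeasurableSet.univ_pi hs)]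
  calc _ = ∫⁻ x : ι → E, ENNReal.ofReal (∏ i, (s i).indicator ρ (x i)) ∂Measure.pi fun _ => μ := by
        refine lintegral_congr fun x => ?_
        by_cases hx : x ∈ Set.univ.pi s
        · rw [Set.indicator_of_mem hx]
          congr 1
          exact Finset.prod_congr rfl fun i _ => (Set.indicator_of_mem (hx i trivial) _).symm
        · rw [Set.indicator_of_notMem hx]
          obtain ⟨i, hi⟩ : ∃ i, x i ∉ s i := by simpa [Set.mem_pi] using hx
          rw [Finset.prod_eq_zero (Finset.mem_univ i) (Set.indicator_of_notMem hi _)]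
          simp
    _ = ENNReal.ofReal (∏ i, ∫ x, (s i).indicator ρ x ∂μ) := by
        rw [← ofReal_integral_eq_lintegral_ofReal (Integrable.fintype_prod hind)
          (ae_of_all _ fun x => Finset.prod_nonneg fun i _ => hpos i _),
          integral_fintype_prod_eq_prod]
    _ = _ := by
        rw [ENNReal.ofReal_prod_of_nonneg fun i _ => integral_nonneg (hpos i)]
        refine Finset.prod_congr rfl fun i _ => ?_
        rw [withDensity_apply _ (hs i), integral_indicator (hs i),
          ofReal_integral_eq_lintegral_ofReal hint.integrableOn (ae_of_all _ hρ0)]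

lemma MeasureTheory.MeasurePreserving.map_withDensity_equiv {α β : Type*} [MeasurableSpace α]
    [MeasurableSpace β] {μ : Measure α} {ν : Measure β} {e : α ≃ᵐ β}
    (he : MeasurePreserving e μ ν) (g : β → ℝ≥0∞) :
    (μ.withDensity fun x => g (e x)).map e = ν.withDensity g := by
  ext s hs
  rw [Measure.map_apply e.measurable hs, withDensity_apply _ (e.measurable hs),
    withDensity_apply _ hs]
  exact he.setLIntegral_comp_preimage_emb e.measurableEmbedding g s

/-- The convex set in the definition of a log-concave measure can be taken open, since the boundary
of a convex set is a null set; the density is then measurable. -/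
lemma IsLogConcave.exists_isOpen {k : ℕ} {μ : Measure (EuclideanSpace ℝ (Fin k))}
    (h : IsLogConcave μ) :
    ∃ (S : Set (EuclideanSpace ℝ (Fin k))) (V : EuclideanSpace ℝ (Fin k) → ℝ),
      IsOpen S ∧ ConvexOn ℝ S V ∧ Measurable (S.indicator fun x => Real.exp (-V x)) ∧
        μ = volume.withDensity
          fun x => ENNReal.ofReal (S.indicator (fun x => Real.exp (-V x)) x) := by
  obtain ⟨S, V, hV, rfl⟩ := h
  refine ⟨interior S, V, isOpen_interior, hV.subset interior_subset hV.1.interior, ?_, ?_⟩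
  · classical
    rw [← Set.piecewise_eq_indicator]
    exact ContinuousOn.measurable_piecewise
      (Real.continuous_exp.comp_continuousOn hV.continuousOn_interior.neg) continuousOn_const
      isOpen_interior.measurableSet
  · refine withDensity_congr_ae ?_
    have hnull := hV.1.addHaar_frontier volume
    filter_upwards [measure_eq_zero_iff_ae_notMem.1 hnull] with x hx
    by_cases hxS : x ∈ S
    · have hxi : x ∈ interior S := by
        by_contra hxi
        exact hx ⟨subset_closure hxS, hxi⟩
      simp [hxS, hxi]
    · have hxi : x ∉ interior S := fun hxi => hxS (interior_subset hxi)
      simp [hxS, hxi]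

/-- The `i`-th block of length `k` of a vector of length `n * k`. -/
noncomputable def blockProj (n k : ℕ) (i : Fin n) :
    EuclideanSpace ℝ (Fin (n * k)) →ₗ[ℝ] EuclideanSpace ℝ (Fin k) where
  toFun y := WithLp.toLp 2 fun l => y (finProdFinEquiv (i, l))
  map_add' _ _ := rfl
  map_smul' _ _ := rfl

lemma continuous_blockProj (n k : ℕ) (i : Fin n) : Continuous (blockProj n k i) :=
  (blockProj n k i).continuous_of_finiteDimensional

/-- Concatenation of `n` vectors of length `k` into one of length `n * k`. -/
noncomputable def concat (n k : ℕ) :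
    (Fin n → EuclideanSpace ℝ (Fin k)) ≃ᵐ EuclideanSpace ℝ (Fin (n * k)) where
  toFun x := WithLp.toLp 2 fun j => x (finProdFinEquiv.symm j).1 (finProdFinEquiv.symm j).2
  invFun y i := blockProj n k i y
  left_inv x := by
    ext i l
    change x (finProdFinEquiv.symm (finProdFinEquiv (i, l))).1
      (finProdFinEquiv.symm (finProdFinEquiv (i, l))).2 = x i l
    rw [Equiv.symm_apply_apply]
  right_inv y := by
    ext j
    change y (finProdFinEquiv (finProdFinEquiv.symm j)) = y j
    rw [Equiv.apply_symm_apply]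
  measurable_toFun := by
    change Measurable fun x : Fin n → EuclideanSpace ℝ (Fin k) => WithLp.toLp 2
      fun j => x (finProdFinEquiv.symm j).1 (finProdFinEquiv.symm j).2
    fun_prop
  measurable_invFun := measurable_pi_lambda _ fun i => (continuous_blockProj n k i).measurable

lemma concat_apply (n k : ℕ) (x : Fin n → EuclideanSpace ℝ (Fin k)) (j : Fin (n * k)) :
    concat n k x j = x (finProdFinEquiv.symm j).1 (finProdFinEquiv.symm j).2 := rfl

lemma blockProj_concat (n k : ℕ) (x : Fin n → EuclideanSpace ℝ (Fin k)) (i : Fin n) :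
    blockProj n k i (concat n k x) = x i :=
  congrFun ((concat n k).symm_apply_apply x) i

lemma norm_concat_sub_sq (n k : ℕ) (x z : Fin n → EuclideanSpace ℝ (Fin k)) :
    ‖concat n k x - concat n k z‖ ^ 2 = ∑ i, ‖x i - z i‖ ^ 2 := by
  simp_rw [EuclideanSpace.norm_sq_eq]
  rw [← finProdFinEquiv.sum_comp, Fintype.sum_prod_type]
  simp [concat_apply]

lemma measurePreserving_concat (n k : ℕ) :
    MeasurePreserving (concat n k) (Measure.pi fun _ => volume) volume := by
  have hm : Measurable fun (x : Fin n → EuclideanSpace ℝ (Fin k)) (j : Fin (n * k)) =>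
      x (finProdFinEquiv.symm j).1 (finProdFinEquiv.symm j).2 := by fun_prop
  refine (PiLp.volume_preserving_toLp (Fin (n * k))).comp ⟨hm, (Measure.pi_eq fun s hs => ?_).symm⟩
  rw [Measure.map_apply hm (MeasurableSet.univ_pi hs)]
  have hpre : (fun (x : Fin n → EuclideanSpace ℝ (Fin k)) (j : Fin (n * k)) =>
      x (finProdFinEquiv.symm j).1 (finProdFinEquiv.symm j).2) ⁻¹' Set.univ.pi s =
      Set.univ.pi fun i => WithLp.ofLp ⁻¹' Set.univ.pi fun l => s (finProdFinEquiv (i, l)) := by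
    ext x
    simp only [Set.mem_preimage, Set.mem_univ_pi]
    rw [← finProdFinEquiv.forall_congr_right, Prod.forall]
    simp
  rw [hpre, Measure.pi_pi, ← finProdFinEquiv.prod_comp, Fintype.prod_prod_type]
  refine Finset.prod_congr rfl fun i _ => ?_
  rw [(PiLp.volume_preserving_ofLp (Fin k)).measure_preimage
    (MeasurableSet.univ_pi fun l => hs _).nullMeasurableSet, volume_pi_pi]

/-- The `n`-th power of a measure on `ℝ^k`, as a measure on `ℝ^(n * k)`. -/
noncomputable def powMeasure {k : ℕ} (μ : Measure (EuclideanSpace ℝ (Fin k))) (n : ℕ) :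
    Measure (EuclideanSpace ℝ (Fin (n * k))) :=
  (Measure.pi fun _ => μ).map (concat n k)

instance {k : ℕ} (μ : Measure (EuclideanSpace ℝ (Fin k))) [IsProbabilityMeasure μ] (n : ℕ) :
    IsProbabilityMeasure (powMeasure μ n) :=
  Measure.isProbabilityMeasure_map (concat n k).measurable.aemeasurable

lemma IsLogConcave.powMeasure {k : ℕ} {μ : Measure (EuclideanSpace ℝ (Fin k))}
    [IsProbabilityMeasure μ] (h : IsLogConcave μ) (n : ℕ) : IsLogConcave (powMeasure μ n) := by
  obtain ⟨S, V, hS, hV, hm, hμ⟩ := h.exists_isOpen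
  have hnn : (0 : EuclideanSpace ℝ (Fin k) → ℝ) ≤ S.indicator fun x => Real.exp (-V x) :=
    Set.indicator_nonneg fun x _ => (Real.exp_pos _).le
  have hint : Integrable (S.indicator fun x => Real.exp (-V x)) volume := by
    refine ⟨hm.aestronglyMeasurable, ?_⟩
    rw [hasFiniteIntegral_iff_ofReal (ae_of_all _ hnn), ← setLIntegral_univ,
      ← withDensity_apply _ MeasurableSet.univ, ← hμ]
    exact measure_lt_top _ _
  refine ⟨⋂ i, blockProj n k i ⁻¹' S, fun y => ∑ i, V (blockProj n k i y), ?_, ?_⟩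
  · have hconv : Convex ℝ (⋂ i, blockProj n k i ⁻¹' S) :=
      convex_iInter fun i => (hV.comp_linearMap (blockProj n k i)).1
    refine ⟨hconv, fun x hx y hy s t hs ht hst => ?_⟩
    simp only [smul_eq_mul, Finset.mul_sum, ← Finset.sum_add_distrib]
    refine Finset.sum_le_sum fun i _ => ?_
    exact (hV.comp_linearMap (blockProj n k i)).2 (Set.mem_iInter.1 hx i) (Set.mem_iInter.1 hy i)
      hs ht hst
  · have hpi := Measure.pi_withDensity_ofReal (ι := Fin n) volume hnn hint
    rw [← hμ] at hpi
    rw [_root_.powMeasure, hpi, ← (measurePreserving_concat n k).map_withDensity_equiv]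
    congr 2
    funext x
    by_cases hx : ∀ i, x i ∈ S
    · rw [Set.indicator_of_mem (by simpa [blockProj_concat] using hx)]
      simp only [blockProj_concat]
      rw [← Finset.sum_neg_distrib, Real.exp_sum]
      congr 1
      exact Finset.prod_congr rfl fun i _ => Set.indicator_of_mem (hx i) _
    · rw [Set.indicator_of_notMem (by simpa [blockProj_concat] using hx)]
      push Not at hx
      obtain ⟨i, hi⟩ := hx
      rw [Finset.prod_eq_zero (Finset.mem_univ i) (Set.indicator_of_notMem hi _),
        ENNReal.ofReal_zero]

lemma IsIsotropic.integrable_sq {k : ℕ} {μ : Measure (EuclideanSpace ℝ (Fin k))}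
    (h : IsIsotropic μ) (l : Fin k) : Integrable (fun x => x l * x l) μ := by
  refine Integrable.of_integral_ne_zero ?_
  rw [h.2 l l]
  simp

lemma IsIsotropic.integrable_norm_sq {k : ℕ} {μ : Measure (EuclideanSpace ℝ (Fin k))}
    (h : IsIsotropic μ) : Integrable (fun x => ‖x‖ ^ 2) μ := by
  simp_rw [EuclideanSpace.norm_sq_eq, Real.norm_eq_abs, sq_abs, pow_two]
  exact integrable_finsetSum _ fun l _ => h.integrable_sq l

lemma IsIsotropic.integrable_id {k : ℕ} {μ : Measure (EuclideanSpace ℝ (Fin k))}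
    [IsProbabilityMeasure μ] (h : IsIsotropic μ) : Integrable (fun x => x) μ := by
  refine ((integrable_const (1 : ℝ)).add h.integrable_norm_sq).mono' (by fun_prop)
    (ae_of_all _ fun x => ?_)
  change ‖x‖ ≤ 1 + ‖x‖ ^ 2
  nlinarith [sq_nonneg (‖x‖ - 1)]

lemma IsIsotropic.powMeasure {k : ℕ} {μ : Measure (EuclideanSpace ℝ (Fin k))}
    [IsProbabilityMeasure μ] (h : IsIsotropic μ) (n : ℕ) : IsIsotropic (powMeasure μ n) := by
  have hcoord : ∀ l, ∫ x, x l ∂μ = 0 := fun l => by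
    have := (EuclideanSpace.proj (𝕜 := ℝ) l).integral_comp_comm h.integrable_id
    rw [h.1, map_zero] at this
    exact this
  have hcm : ∀ l : Fin k, Measurable fun x : EuclideanSpace ℝ (Fin k) => x l := fun l => by fun_prop
  constructor
  · rw [_root_.powMeasure, (concat n k).measurableEmbedding.integral_map]
    have hint : ∀ j, Integrable (fun x => concat n k x j) (Measure.pi fun _ => μ) := fun j =>
      integrable_comp_eval (μ := fun _ : Fin n => μ)
        ((EuclideanSpace.proj (𝕜 := ℝ) (finProdFinEquiv.symm j).2).integrable_comp h.integrable_id)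
    ext j
    rw [eval_integral_piLp hint]
    simp only [concat_apply]
    rw [integral_comp_eval (μ := fun _ : Fin n => μ) (f := fun x => x (finProdFinEquiv.symm j).2)
      (by fun_prop), hcoord]
    rfl
  · intro j j'
    rw [_root_.powMeasure, (concat n k).measurableEmbedding.integral_map]
    simp only [concat_apply]
    obtain ⟨⟨i, l⟩, rfl⟩ := finProdFinEquiv.surjective j
    obtain ⟨⟨i', l'⟩, rfl⟩ := finProdFinEquiv.surjective j'
    simp only [Equiv.symm_apply_apply, EmbeddingLike.apply_eq_iff_eq, Prod.mk.injEq]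
    rcases eq_or_ne i i' with rfl | hne
    · rw [integral_comp_eval (μ := fun _ : Fin n => μ) (i := i) (f := fun x => x l * x l')
        (by fun_prop), h.2 l l']
      simp
    · have hind := (iIndepFun_pi (μ := fun _ : Fin n => μ)
        (X := fun _ (x : EuclideanSpace ℝ (Fin k)) => x) fun _ => aemeasurable_id).indepFun hne
      have hind' := hind.comp (hcm l) (hcm l')
      have hmul := hind'.integral_mul_eq_mul_integral
        ((hcm l).comp (measurable_pi_apply i)).aestronglyMeasurable
        ((hcm l').comp (measurable_pi_apply i')).aestronglyMeasurable
      simp only [Pi.mul_apply, Function.comp_apply] at hmul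
      rw [hmul, integral_comp_eval (μ := fun _ : Fin n => μ) (i := i) (f := fun x => x l)
        (by fun_prop), hcoord]
      simp [hne]

/-- Enlargement by a Euclidean ball in `ℝ^(n * k)` is enlargement in the `ℓ²` product distance. -/
lemma productConcentration_of_powMeasure {k : ℕ} {μ : Measure (EuclideanSpace ℝ (Fin k))}
    {r a : ℝ} (hr : 0 ≤ r)
    (h : ∀ n : ℕ, 0 < n → ∀ A : Set (EuclideanSpace ℝ (Fin (n * k))), MeasurableSet A →
      1 / 2 ≤ powMeasure μ n A → ENNReal.ofReal (1 - a) ≤ powMeasure μ n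
        (A + r • Metric.closedBall (0 : EuclideanSpace ℝ (Fin (n * k))) 1)) :
    ProductConcentration μ r a := by
  intro n hn B hB hB2
  have hAm : MeasurableSet ((concat n k).symm ⁻¹' B) := (concat n k).symm.measurable hB
  have hpre : concat n k ⁻¹' ((concat n k).symm ⁻¹' B) = B := by
    ext x
    simp
  have h1 := h n hn _ hAm (by rwa [powMeasure, MeasurableEquiv.map_apply, hpre])
  rw [powMeasure, MeasurableEquiv.map_apply] at h1
  refine h1.trans (measure_mono fun x hx => ?_)
  obtain ⟨y, hy, w, hw, hyw⟩ := Set.mem_add.1 (Set.mem_preimage.1 hx)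
  rw [smul_closedBall _ _ zero_le_one, smul_zero, Real.norm_of_nonneg hr, mul_one,
    mem_closedBall_zero_iff] at hw
  refine ⟨(concat n k).symm y, hy, ?_⟩
  rw [← norm_concat_sub_sq, MeasurableEquiv.apply_symm_apply, ← hyw, add_sub_cancel_left]
  gcongr

/-! ### The Poincaré inequality and dimension-free concentration -/

theorem corollary2p3 :
    (∃ lam : ℝ, 0 < lam ∧
      ∀ k : ℕ, 0 < k → ∀ μ : Measure (EuclideanSpace ℝ (Fin k)), IsProbabilityMeasure μ →
        IsLogConcave μ → IsIsotropic μ → SatisfiesPoincare μ lam) ↔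
    (∃ r₀ a₀ : ℝ, 0 < r₀ ∧ 0 ≤ a₀ ∧ a₀ < 1 / 2 ∧
      ∀ m : ℕ, 0 < m → ∀ ν : Measure (EuclideanSpace ℝ (Fin m)), IsProbabilityMeasure ν →
        IsLogConcave ν → IsIsotropic ν →
          ∀ A : Set (EuclideanSpace ℝ (Fin m)), MeasurableSet A → 1 / 2 ≤ ν A →
            ENNReal.ofReal (1 - a₀) ≤
              ν (A + r₀ • Metric.closedBall (0 : EuclideanSpace ℝ (Fin m)) 1)) := by
  constructor
  · rintro ⟨lam, hlam, h⟩
    refine ⟨√(8 / lam), 1 / 4, by positivity, by norm_num, by norm_num, ?_⟩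
    intro m hm ν hν hlog hiso A hA hA2
    exact (h m hm ν hν hlog hiso).le_measure_add_closedBall hlam hA hA2
  · rintro ⟨r, a, hr, -, ha, h⟩
    have hp : 1 / 2 < ENNReal.ofReal (1 - a) := by
      rw [show (1 / 2 : ℝ≥0∞) = ENNReal.ofReal (1 / 2) by
        rw [ENNReal.ofReal_div_of_pos two_pos]; simp]
      exact (ENNReal.ofReal_lt_ofReal_iff (by linarith)).2 (by linarith)
    obtain ⟨c, hc0, hc⟩ := exists_pos_gaussianReal_Iic_lt hp
    refine ⟨(c / r) ^ 2, by positivity, fun k hk μ hμ hlog hiso => ?_⟩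
    refine ProductConcentration.satisfiesPoincare hr ?_ hc0 hc hiso.integrable_norm_sq
    exact productConcentration_of_powMeasure hr.le fun n hn A hA hA2 =>
      h (n * k) (Nat.mul_pos hn hk) _ inferInstance (hlog.powMeasure n) (hiso.powMeasure n) A hA hA2
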